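/- Let $d \geq 2$ be an integer and $\zeta \in \mathbb{C}^\times$ a primitive $d$-th root of unity. Let $V=\mathbb{C}^2$ with canonical basis $(x,y)$, let $(X,Y)$ be the dual basis of $V^*$, and identify $\mathbb{C}[V\times V^*]$ with $\mathbb{C}[x,y,X,Y]$, on which $\mathrm{GL}(V)$ acts through its natural actions on $V$ (the span of $x,y$) and $V^*$ (the span of $X,Y$). For $i \in \mathbb{Z}$ put $s_i=\begin{pmatrix} 0 & \zeta^i\\ \zeta^{-i} & 0\end{pmatrix}$, and let $W=\langle s_0,s_1\rangle \subset \mathrm{GL}_2(\mathbb{C})$, the dihedral group of order $2d$. Put $$q=xy,\qquad Q=XY,\qquad \mathbf{eu}_0=xX+yY,\qquad \mathbf{a}_{i,0}=x^{d-i}Y^i+y^{d-i}X^i\quad(0\leq i\leq d).$$ Let $\Psi_k(T,T',T'')$ $(k\geq 0)$ be the polynomials given by $\Psi_0=1$, $\Psi_1=T$, $\Psi_{k+1}=T\Psi_k-T'T''\Psi_{k-1}$ for $k \geq 1$; equivalently, $\Psi_k$ is the unique polynomial with $\Psi_k(\mathbf{eu}_0,q,Q)=\dfrac{(xX)^{k+1}-(yY)^{k+1}}{xX-yY}$.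 **Theorem.** The algebra of invariants $\mathbb{C}[V\times V^*]^W$ admits the following presentation as a commutative $\mathbb{C}$-algebra. Generators: $q,\ Q,\ \mathbf{eu}_0,\ \mathbf{a}_{0,0},\ \mathbf{a}_{1,0},\dots,\mathbf{a}_{d,0}$. Relations: $$\begin{cases}\mathbf{eu}_0\,\mathbf{a}_{i,0}=q\,\mathbf{a}_{i+1,0}+Q\,\mathbf{a}_{i-1,0} & \text{for } 1\leq i\leq d-1,\\ \mathbf{a}_{i-1,0}\mathbf{a}_{j+1,0}-\mathbf{a}_{i,0}\mathbf{a}_{j,0}=(\mathbf{eu}_0^2-4qQ)\,q^{d-j-1}Q^{i-1}\,\Psi_{j-i}(\mathbf{eu}_0,q,Q) & \text{for } 1\leq i\leq j\leq d-1.\end{cases}$$ That is, the algebra homomorphism from the polynomial ring in $d+4$ variables to $\mathbb{C}[V\times V^*]$ that sends the variables to these elements has image $\mathbb{C}[V\times V^*]^W$, and its kernel is the ideal generated by the (left-hand side minus right-hand side of the) relations above. -/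

import Mathlib

namespace DihedralInvariants

open MvPolynomial

noncomputable section

/-- The reflection `s_i`, the antidiagonal matrix with entries `ζ ^ i` and `ζ ^ (-i)`. -/
def s (ζ : ℂˣ) (i : ℤ) : GL (Fin 2) ℂ where
  val := !![0, ((ζ ^ i : ℂˣ) : ℂ); ((ζ ^ (-i) : ℂˣ) : ℂ), 0]
  inv := !![0, ((ζ ^ i : ℂˣ) : ℂ); ((ζ ^ (-i) : ℂˣ) : ℂ), 0]
  val_inv := by
    rw [Matrix.mul_fin_two, Matrix.one_fin_two]
    simp [zpow_ne_zero]
  inv_val := by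
    rw [Matrix.mul_fin_two, Matrix.one_fin_two]
    simp [zpow_ne_zero]

/-- The group `W = ⟨s, t⟩` with `s = s_0` and `t = s_1`. It is the dihedral group of order `2 d`
when `ζ` is a primitive `d`-th root of unity. -/
def W (ζ : ℂˣ) : Subgroup (GL (Fin 2) ℂ) := Subgroup.closure {s ζ 0, s ζ 1}

/-- `ℂ[V × V*]` for `V = ℂ²`. The variables `Sum.inl 0, Sum.inl 1` are the canonical basis `x, y`
of `V` (linear functions on `V*`), the variables `Sum.inr 0, Sum.inr 1` are the dual basis
`X, Y` of `V*` (linear functions on `V`). -/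
abbrev Poly : Type := MvPolynomial (Fin 2 ⊕ Fin 2) ℂ

def x : Poly := MvPolynomial.X (Sum.inl 0)
def y : Poly := MvPolynomial.X (Sum.inl 1)
def X : Poly := MvPolynomial.X (Sum.inr 0)
def Y : Poly := MvPolynomial.X (Sum.inr 1)

/-- The action of `g ∈ GL(V)` on `ℂ[V × V*]` by algebra automorphisms: on the span of `x, y` it is
the natural action on `V`, and on the span of `X, Y` it is the contragredient action on `V*`. -/
def act (g : GL (Fin 2) ℂ) : Poly →ₐ[ℂ] Poly :=
  aeval (Sum.elim
    (fun j => ∑ i, C (g.val i j) * MvPolynomial.X (Sum.inl i))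
    (fun j => ∑ i, C ((g⁻¹).val j i) * MvPolynomial.X (Sum.inr i)))

/-- As a function on `V × V*`, the polynomial `act g f` is `(v, ξ) ↦ f (g⁻¹ v, g⁻¹ ξ)`, where
`g⁻¹ ξ = ξ ∘ g` has coordinates `ξ ᵥ* g`. -/
theorem eval_act (g : GL (Fin 2) ℂ) (f : Poly) (v ξ : Fin 2 → ℂ) :
    eval (Sum.elim ξ v) (act g f) =
      eval (Sum.elim (Matrix.vecMul ξ g.val) (Matrix.mulVec (g⁻¹).val v)) f := by
  have h : (aeval (R := ℂ) (Sum.elim ξ v)).comp (act g) =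
      aeval (Sum.elim (Matrix.vecMul ξ g.val) (Matrix.mulVec (g⁻¹).val v)) := by
    refine MvPolynomial.algHom_ext ?_
    rintro (j | j)
    · simp [act, Matrix.vecMul, dotProduct, mul_comm]
    · fin_cases j <;> simp [act]
  simpa [aeval_eq_eval] using DFunLike.congr_fun h f

/-- The invariant algebra `ℂ[V × V*]^G` of a subgroup `G` of `GL(V)`. -/
def invariants (G : Subgroup (GL (Fin 2) ℂ)) : Subalgebra ℂ Poly :=
  ⨅ g ∈ G, AlgHom.equalizer (act g) (AlgHom.id ℂ Poly)

theorem mem_invariants (G : Subgroup (GL (Fin 2) ℂ)) (f : Poly) :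
    f ∈ invariants G ↔ ∀ g ∈ G, act g f = f := by
  simp [invariants, Algebra.mem_iInf, AlgHom.mem_equalizer]

def q : Poly := x * y
def Q : Poly := X * Y
def eu : Poly := x * X + y * Y

/-- The element `a_{i,0}` of `ℂ[V × V*]`, for `0 ≤ i ≤ d`. -/
def a (d i : ℕ) : Poly := x ^ (d - i) * Y ^ i + y ^ (d - i) * X ^ i

/-- The polynomials `Ψ_i (T, T', T'')`, where `T, T', T''` are the variables `0, 1, 2`. -/
def Psi : ℕ → MvPolynomial (Fin 3) ℂ
  | 0 => 1
  | 1 => MvPolynomial.X 0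
  | n + 2 => MvPolynomial.X 0 * Psi (n + 1) - MvPolynomial.X 1 * MvPolynomial.X 2 * Psi n

/-- The identity that characterizes `Ψ_i`. -/
theorem aeval_Psi (i : ℕ) :
    aeval ![eu, q, Q] (Psi i) * (x * X - y * Y) = (x * X) ^ (i + 1) - (y * Y) ^ (i + 1) := by
  induction i using Nat.twoStepInduction with
  | zero => simp [Psi]
  | one => simp [Psi, eu]; ring
  | more n h0 h1 =>
    have h : aeval ![eu, q, Q] (Psi (n + 2)) * (x * X - y * Y)
        = eu * (aeval ![eu, q, Q] (Psi (n + 1)) * (x * X - y * Y))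
          - q * Q * (aeval ![eu, q, Q] (Psi n) * (x * X - y * Y)) := by
      simp [Psi]; ring
    rw [h, h0, h1, eu, q, Q]
    ring

/-- `Ψ_i` is the only polynomial with that property. -/
theorem eq_Psi (i : ℕ) (P : MvPolynomial (Fin 3) ℂ)
    (hP : aeval ![eu, q, Q] P * (x * X - y * Y) = (x * X) ^ (i + 1) - (y * Y) ^ (i + 1)) :
    P = Psi i := by
  have hne : x * X - y * Y ≠ 0 := by
    intro h
    have h1 := congrArg (eval (Sum.elim ![1, 0] ![1, 0] : Fin 2 ⊕ Fin 2 → ℂ)) h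
    simp [x, y, X, Y] at h1
  have h0 : aeval ![eu, q, Q] (P - Psi i) = 0 := by
    rw [map_sub, sub_eq_zero]
    exact mul_right_cancel₀ hne (hP.trans (aeval_Psi i).symm)
  have key : (P - Psi i) * (MvPolynomial.X 1 * MvPolynomial.X 2) = 0 := by
    refine MvPolynomial.funext fun w => ?_
    simp only [map_mul, eval_X, map_zero]
    by_cases h1 : w 1 = 0
    · simp [h1]
    by_cases h2 : w 2 = 0
    · simp [h2]
    obtain ⟨r, hr⟩ := IsAlgClosed.exists_pow_nat_eq (discrim (w 1) (-w 0) (w 2)) (n := 2) (by simp)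
    obtain ⟨u, hu⟩ := exists_quadratic_eq_zero h1 ⟨r, by rw [← hr]; ring⟩
    have hu0 : u ≠ 0 := by
      rintro rfl
      simp [h2] at hu
    have h3 : (aeval (R := ℂ) (Sum.elim ![w 1, 1] ![u, w 2 / u])).comp (aeval ![eu, q, Q])
        = aeval w := by
      refine MvPolynomial.algHom_ext fun k => ?_
      fin_cases k
      · simp [eu, x, y, X, Y]
        field_simp
        linear_combination hu
      · simp [q, x, y]
      · simp [Q, X, Y]
        field_simp
    have h4 := DFunLike.congr_fun h3 (P - Psi i)
    rw [AlgHom.comp_apply, h0, map_zero] at h4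
    rw [← aeval_eq_eval w]
    exact mul_eq_zero_of_left h4.symm _
  have hX : (MvPolynomial.X 1 * MvPolynomial.X 2 : MvPolynomial (Fin 3) ℂ) ≠ 0 :=
    mul_ne_zero (X_ne_zero _) (X_ne_zero _)
  exact sub_eq_zero.mp ((mul_eq_zero.mp key).resolve_right hX)

/-- The symbols `q, Q, eu_0, a_{0,0}, …, a_{d,0}` of the presentation. -/
inductive Gen (d : ℕ) : Type
  | q : Gen d
  | Q : Gen d
  | eu : Gen d
  | a (i : Fin (d + 1)) : Gen d

/-- The element of `ℂ[V × V*]` that a symbol stands for. -/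
def Gen.toPoly {d : ℕ} : Gen d → Poly
  | .q => DihedralInvariants.q
  | .Q => DihedralInvariants.Q
  | .eu => DihedralInvariants.eu
  | .a i => DihedralInvariants.a d i

/-- The relations `eu_0 a_{i,0} = q a_{i+1,0} + Q a_{i-1,0}` for `1 ≤ i ≤ d - 1`, written as
elements (left-hand side minus right-hand side) of the free commutative algebra. -/
def relLinear (d : ℕ) : Set (MvPolynomial (Gen d) ℂ) :=
  {r | ∃ (i : ℕ) (_ : 1 ≤ i) (_ : i ≤ d - 1),
    r = .X .eu * .X (.a ⟨i, by omega⟩)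
      - (.X .q * .X (.a ⟨i + 1, by omega⟩) + .X .Q * .X (.a ⟨i - 1, by omega⟩))}

/-- The relations `a_{i-1,0} a_{j+1,0} - a_{i,0} a_{j,0} =
(eu_0 ^ 2 - 4 q Q) q ^ (d-j-1) Q ^ (i-1) Ψ_{j-i} (eu_0, q, Q)` for `1 ≤ i ≤ j ≤ d - 1`. -/
def relQuadratic (d : ℕ) : Set (MvPolynomial (Gen d) ℂ) :=
  {r | ∃ (i j : ℕ) (_ : 1 ≤ i) (_ : i ≤ j) (_ : j ≤ d - 1),
    r = (.X (.a ⟨i - 1, by omega⟩) * .X (.a ⟨j + 1, by omega⟩)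
        - .X (.a ⟨i, by omega⟩) * .X (.a ⟨j, by omega⟩))
      - (.X .eu ^ 2 - 4 * .X .q * .X .Q) * .X .q ^ (d - j - 1) * .X .Q ^ (i - 1)
        * aeval ![.X .eu, .X .q, .X .Q] (Psi (j - i))}

end

end DihedralInvariants

namespace DihedralInvariants
open MvPolynomial

/-! The image is found by averaging. The product of the two reflections acts diagonally, so an
invariant involves only monomials on which `x, Y` (weight 1) and `y, X` (weight -1) have total
weights congruent mod `d`. Averaging over `s ζ 0` turns it into a combination of the orbit sums
`symMonomial`, and induction on the degree expresses these in the generators (`symMonomial_mem`).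

The kernel is found by a rank count over the ring `P` of polynomials in `q, Q, a_0, a_d`, which are
algebraically independent (`parameterMap_injective`). Let `B` be the algebra defined by the
presentation. The relations show that `B` is spanned over `P` by the `2 * d` elements `1, e, …, e ^
d, a_1, …, a_{d-1}` (`Relations.span_family_eq_top`). In `Poly`, the element `eu` has `2 * d`
distinct conjugates over `P`, so `1, eu, …, eu ^ (2 * d - 1)` are independent
(`linearIndependent_eu_pow`). A `P`-linear map from a module with `2 * d` generators whose image has
`2 * d` independent elements is injective, so `B` embeds in `Poly` and there are no further
relations. -/

/-- A homomorphism out of a module with `n` generators is injective as soon as its range contains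
`n` linearly independent elements. -/
theorem injective_of_span_of_linearIndependent {P M N : Type*} [CommRing P] [IsDomain P]
    [AddCommGroup M] [Module P M] [AddCommGroup N] [Module P N] {n : ℕ} (π : M →ₗ[P] N)
    (b : Fin n → M) (hb : Submodule.span P (Set.range b) = ⊤) (v : Fin n → M)
    (hv : LinearIndependent P fun k => π (v k)) : Function.Injective π := by
  have hrep : ∀ m : M, ∃ c : Fin n → P, ∑ k, c k • b k = m := fun m =>
    (Submodule.mem_span_range_iff_exists_fun P).1 (hb ▸ Submodule.mem_top)
  choose A hA using fun k => hrep (v k)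
  let A' : Matrix (Fin n) (Fin n) P := Matrix.of A
  have hvA : ∀ w : Fin n → P, ∑ k, w k • v k = ∑ l, (Matrix.vecMul w A') l • b l := by
    intro w
    simp_rw [← hA, Finset.smul_sum, smul_smul, Matrix.vecMul, dotProduct, Finset.sum_smul]
    rw [Finset.sum_comm]
    rfl
  have hind : ∀ w : Fin n → P, π (∑ l, (Matrix.vecMul w A') l • b l) = 0 → w = 0 := by
    intro w hw
    rw [← hvA, map_sum] at hw
    simp_rw [map_smul] at hw
    exact funext (Fintype.linearIndependent_iff.1 hv w hw)
  have hdet : A'.det ≠ 0 := by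
    intro h
    obtain ⟨w, hw0, hw⟩ := Matrix.exists_vecMul_eq_zero_iff.2 h
    exact hw0 (hind w (by simp [hw]))
  rw [← LinearMap.ker_eq_bot, LinearMap.ker_eq_bot']
  intro m hm
  obtain ⟨c, rfl⟩ := hrep m
  -- By Cramer's rule, `A'.det` times an element of the kernel is a combination of the `v k`, and
  -- `hind` then kills its coefficients.
  have hc : Matrix.vecMul (Matrix.vecMul c A'.adjugate) A' = A'.det • c := by
    rw [Matrix.vecMul_vecMul, Matrix.adjugate_mul, Matrix.vecMul_smul, Matrix.vecMul_one]
  have h0 := hind (Matrix.vecMul c A'.adjugate) (by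
    rw [hc]
    simp_rw [Pi.smul_apply, smul_assoc, ← Finset.smul_sum, map_smul, hm, smul_zero])
  rw [h0, Matrix.zero_vecMul] at hc
  have hc0 : c = 0 := (smul_eq_zero.1 hc.symm).resolve_left hdet
  simp [hc0]

/-! ### The presented algebra as a module over the parameters -/

section Spanning

variable {P B : Type*} [CommRing P] [CommRing B] [Algebra P B]

/-- The span of the powers `e ^ j` with `j < n`. -/
def powSpan (P : Type*) {B : Type*} [CommRing P] [CommRing B] [Algebra P B] (e : B) (n : ℕ) :
    Submodule P B :=
  Submodule.span P {z | ∃ j < n, z = e ^ j}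

theorem pow_mem_powSpan (e : B) {j n : ℕ} (h : j < n) : e ^ j ∈ powSpan P e n :=
  Submodule.subset_span ⟨j, h, rfl⟩

theorem powSpan_mono (e : B) {m n : ℕ} (h : m ≤ n) : powSpan P e m ≤ powSpan P e n :=
  Submodule.span_mono fun _ ⟨j, hj, hz⟩ => ⟨j, hj.trans_le h, hz⟩

theorem mul_mem_powSpan (e : B) {n : ℕ} {z : B} (hz : z ∈ powSpan P e n) :
    e * z ∈ powSpan P e (n + 1) := by
  induction hz using Submodule.span_induction with
  | mem z hz =>
    obtain ⟨j, hj, rfl⟩ := hz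
    rw [← pow_succ']
    exact pow_mem_powSpan e (by omega)
  | zero => simp
  | add u v _ _ hu hv => rw [mul_add]; exact add_mem hu hv
  | smul c u _ hu => rw [mul_smul_comm]; exact Submodule.smul_mem _ _ hu

/-- The values of the polynomials `Psi` in an arbitrary algebra. -/
def psi (e p : B) : ℕ → B
  | 0 => 1
  | 1 => e
  | n + 2 => e * psi e p (n + 1) - p * psi e p n

theorem aeval_Psi_eq_psi [Algebra ℂ B] (e q Q : B) (n : ℕ) :
    aeval ![e, q, Q] (Psi n) = psi e (q * Q) n := by
  induction n using Nat.twoStepInduction with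
  | zero => simp [Psi, psi]
  | one => simp [Psi, psi]
  | more n h0 h1 => simp [Psi, psi, h0, h1]

theorem psi_sub_pow_mem (e : B) (p : P) (n : ℕ) :
    psi e (algebraMap P B p) n - e ^ n ∈ powSpan P e n := by
  induction n using Nat.twoStepInduction with
  | zero => simp [psi]
  | one => simp [psi]
  | more n h0 h1 =>
    have h2 : psi e (algebraMap P B p) (n + 2) - e ^ (n + 2)
        = e * (psi e (algebraMap P B p) (n + 1) - e ^ (n + 1))
          - (p • (psi e (algebraMap P B p) n - e ^ n) + p • e ^ n) := by
      simp only [psi, Algebra.smul_def]; ring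
    rw [h2]
    refine sub_mem (mul_mem_powSpan e h1) (add_mem (Submodule.smul_mem _ _ ?_)
      (Submodule.smul_mem _ _ (pow_mem_powSpan e (by omega))))
    exact powSpan_mono e (by omega) h0

/-- `psi e p n` is monic of degree `n` in `e`, so the non-scalar factor on the right of the
quadratic relations is monic of degree `j - i + 2 ≤ d`. -/
theorem sq_sub_mul_psi_sub_pow_mem (e : B) (p r : P) (n : ℕ) :
    (e ^ 2 - algebraMap P B r) * psi e (algebraMap P B p) n - e ^ (n + 2)
      ∈ powSpan P e (n + 2) := by
  have h := psi_sub_pow_mem e p n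
  have h2 : (e ^ 2 - algebraMap P B r) * psi e (algebraMap P B p) n - e ^ (n + 2)
      = e * (e * (psi e (algebraMap P B p) n - e ^ n))
        - (r • (psi e (algebraMap P B p) n - e ^ n) + r • e ^ n) := by
    simp only [Algebra.smul_def]; ring
  rw [h2]
  refine sub_mem (mul_mem_powSpan e (mul_mem_powSpan e h)) (add_mem (Submodule.smul_mem _ _
    (powSpan_mono e (by omega) h)) (Submodule.smul_mem _ _ (pow_mem_powSpan e (by omega))))

/-- The defining relations of the presentation, over a base ring `P` that contains
`q, Q, a_0, a_d`. -/
structure Relations (d : ℕ) (q Q α δ : P) (e : B) (a : ℕ → B) : Prop where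
  zero : a 0 = algebraMap P B α
  last : a d = algebraMap P B δ
  linear : ∀ i, 1 ≤ i → i ≤ d - 1 → e * a i = q • a (i + 1) + Q • a (i - 1)
  quadratic : ∀ i j, 1 ≤ i → i ≤ j → j ≤ d - 1 → a (i - 1) * a (j + 1) - a i * a j
    = (q ^ (d - j - 1) * Q ^ (i - 1)) •
      ((e ^ 2 - algebraMap P B (4 * q * Q)) * psi e (algebraMap P B (q * Q)) (j - i))

/-- The spanning family `1, e, …, e ^ d, a 1, …, a (d - 1)`. -/
def family (d : ℕ) (e : B) (a : ℕ → B) (k : Fin (2 * d)) : B :=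
  if (k : ℕ) ≤ d then e ^ (k : ℕ) else a (k - d)

variable {d : ℕ} {q Q α δ : P} {e : B} {a : ℕ → B}

theorem powSpan_le_span_family (hd : 2 ≤ d) :
    powSpan P e (d + 1) ≤ Submodule.span P (Set.range (family d e a)) := by
  refine Submodule.span_le.2 ?_
  rintro _ ⟨j, hj, rfl⟩
  refine Submodule.subset_span ⟨⟨j, by omega⟩, ?_⟩
  simp [family, Nat.lt_succ_iff.1 hj]

theorem pow_mem_span_family (hd : 2 ≤ d) {j : ℕ} (hj : j ≤ d) :
    e ^ j ∈ Submodule.span P (Set.range (family d e a)) :=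
  powSpan_le_span_family hd (pow_mem_powSpan e (by omega))

namespace Relations

variable (h : Relations d q Q α δ e a) (hd : 2 ≤ d)
include h hd

theorem mem_span_family {i : ℕ} (hi : i ≤ d) :
    a i ∈ Submodule.span P (Set.range (family d e a)) := by
  have h1 := pow_mem_span_family (P := P) (e := e) (a := a) hd (Nat.zero_le d)
  rw [pow_zero] at h1
  rcases Nat.eq_zero_or_pos i with rfl | hi0
  · rw [h.zero, Algebra.algebraMap_eq_smul_one]
    exact Submodule.smul_mem _ _ h1
  rcases hi.eq_or_lt with rfl | hid
  · rw [h.last, Algebra.algebraMap_eq_smul_one]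
    exact Submodule.smul_mem _ _ h1
  · refine Submodule.subset_span ⟨⟨i + d, by omega⟩, ?_⟩
    have : ¬ i + d ≤ d := by omega
    simp [family, hi0.ne']

/-- The quadratic relation pushes the two indices apart, modulo powers of `e` of exponent at most
`d`, until one of them is `0` or `d` and that factor is a scalar. -/
theorem mul_mem_span_family_of_le {i j : ℕ} (hij : i ≤ j) (hj : j ≤ d) :
    a i * a j ∈ Submodule.span P (Set.range (family d e a)) := by
  induction i generalizing j with
  | zero =>
    rw [h.zero, ← Algebra.smul_def]
    exact Submodule.smul_mem _ _ (h.mem_span_family hd hj)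
  | succ i ih =>
    rcases hj.eq_or_lt with rfl | hjd
    · rw [h.last, mul_comm (a _), ← Algebra.smul_def]
      exact Submodule.smul_mem _ _ (h.mem_span_family hd hij)
    rw [← sub_sub_cancel (a i * a (j + 1)) (a (i + 1) * a j)]
    have h1 := h.quadratic (i + 1) j (by omega) hij (by omega)
    rw [Nat.add_sub_cancel] at h1
    rw [h1]
    refine sub_mem (ih (by omega) (by omega)) (Submodule.smul_mem _ _ ?_)
    have h2 := sq_sub_mul_psi_sub_pow_mem e (q * Q) (4 * q * Q) (j - (i + 1))
    rw [← sub_add_cancel (_ * psi e _ _) (e ^ (j - (i + 1) + 2))]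
    exact add_mem (powSpan_le_span_family hd (powSpan_mono e (by omega) h2))
      (pow_mem_span_family hd (by omega))

theorem mul_mem_span_family {i j : ℕ} (hi : i ≤ d) (hj : j ≤ d) :
    a i * a j ∈ Submodule.span P (Set.range (family d e a)) := by
  rcases le_total i j with hij | hij
  · exact h.mul_mem_span_family_of_le hd hij hj
  · rw [mul_comm (a i)]
    exact h.mul_mem_span_family_of_le hd hij hi

/-- Each factor `e` is traded for a shift of the index by the linear relation. At an end of the
range, `a i` is a scalar and a power `e ^ j` with `j ≤ d` remains. -/
theorem pow_mul_mem_span_family {i j : ℕ} (hi : i ≤ d) (hj : j ≤ d) :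
    e ^ j * a i ∈ Submodule.span P (Set.range (family d e a)) := by
  induction j generalizing i with
  | zero => simpa using h.mem_span_family hd hi
  | succ j ih =>
    rcases Nat.eq_zero_or_pos i with rfl | hi0
    · rw [h.zero, mul_comm (e ^ _), ← Algebra.smul_def]
      exact Submodule.smul_mem _ _ (pow_mem_span_family hd hj)
    rcases hi.eq_or_lt with rfl | hid
    · rw [h.last, mul_comm (e ^ _), ← Algebra.smul_def]
      exact Submodule.smul_mem _ _ (pow_mem_span_family hd hj)
    rw [pow_succ, mul_assoc, h.linear i hi0 (by omega), mul_add, mul_smul_comm, mul_smul_comm]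
    exact add_mem (Submodule.smul_mem _ _ (ih (by omega) (by omega)))
      (Submodule.smul_mem _ _ (ih (by omega) (by omega)))

/-- The quadratic relation with `i = 1`, `j = d - 1` has coefficient 1, so it equates `a_0 a_d - a_1
a_{d-1}` with `e ^ d` plus lower powers. Multiplying by `e` and rewriting `e a_1` by the linear
relation bounds the powers of `e`. -/
theorem pow_succ_mem_span_family :
    e ^ (d + 1) ∈ Submodule.span P (Set.range (family d e a)) := by
  obtain ⟨m, rfl⟩ : ∃ m, d = m + 2 := ⟨d - 2, by omega⟩
  have h1 := h.quadratic 1 (m + 1) le_rfl (by omega) (by omega)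
  have h2 := mul_mem_powSpan e (sq_sub_mul_psi_sub_pow_mem e (q * Q) (4 * q * Q) m)
  have h3 := h.linear 1 le_rfl (by omega)
  have hexp : m + 2 - (m + 1) - 1 = 0 := by omega
  simp only [Nat.sub_self, pow_zero, mul_one, one_smul, Nat.add_sub_cancel, hexp] at h1 h3
  rw [← h1] at h2
  have h4 : e ^ (m + 2 + 1) = e * (a 0 * a (m + 2))
      - (q • (a (1 + 1) * a (m + 1)) + Q • (a 0 * a (m + 1)))
      - e * (a 0 * a (m + 1 + 1) - a 1 * a (m + 1) - e ^ (m + 2)) := by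
    rw [← smul_mul_assoc, ← smul_mul_assoc, ← add_mul, ← h3]
    ring
  rw [h4]
  refine sub_mem (sub_mem ?_ (add_mem (Submodule.smul_mem _ _ ?_) (Submodule.smul_mem _ _ ?_))) ?_
  · rw [h.zero, ← Algebra.smul_def, mul_smul_comm]
    refine Submodule.smul_mem _ _ ?_
    simpa using h.pow_mul_mem_span_family hd (j := 1) le_rfl (by omega)
  · exact h.mul_mem_span_family hd (by omega) (by omega)
  · exact h.mul_mem_span_family hd (by omega) (by omega)
  · exact powSpan_le_span_family hd h2

theorem eu_mul_mem {z : B} (hz : z ∈ Submodule.span P (Set.range (family d e a))) :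
    e * z ∈ Submodule.span P (Set.range (family d e a)) := by
  induction hz using Submodule.span_induction with
  | mem z hz =>
    obtain ⟨k, rfl⟩ := hz
    by_cases hk : (k : ℕ) ≤ d
    · rw [family, if_pos hk, ← pow_succ']
      rcases hk.eq_or_lt with hk | hk
      · rw [hk]
        exact h.pow_succ_mem_span_family hd
      · exact pow_mem_span_family hd hk
    · rw [family, if_neg hk]
      simpa using h.pow_mul_mem_span_family hd (i := k - d) (j := 1) (by omega) (by omega)
  | zero => simp
  | add u v _ _ hu hv => rw [mul_add]; exact add_mem hu hv
  | smul c u _ hu => rw [mul_smul_comm]; exact Submodule.smul_mem _ _ hu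

theorem a_mul_mem {i : ℕ} (hi : i ≤ d) {z : B}
    (hz : z ∈ Submodule.span P (Set.range (family d e a))) :
    a i * z ∈ Submodule.span P (Set.range (family d e a)) := by
  induction hz using Submodule.span_induction with
  | mem z hz =>
    obtain ⟨k, rfl⟩ := hz
    by_cases hk : (k : ℕ) ≤ d
    · rw [family, if_pos hk, mul_comm (a i)]
      exact h.pow_mul_mem_span_family hd hi hk
    · rw [family, if_neg hk]
      exact h.mul_mem_span_family hd hi (by omega)
  | zero => simp
  | add u v _ _ hu hv => rw [mul_add]; exact add_mem hu hv
  | smul c u _ hu => rw [mul_smul_comm]; exact Submodule.smul_mem _ _ hu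

end Relations

end Spanning

/-! ### The action -/

theorem act_mul (g h : GL (Fin 2) ℂ) : act (g * h) = (act g).comp (act h) := by
  refine MvPolynomial.algHom_ext ?_
  rintro (j | j)
  · simp [act, Matrix.mul_apply, Fin.sum_univ_two]
    ring
  · simp [act, Matrix.mul_apply, Fin.sum_univ_two, mul_inv_rev, -Matrix.coe_units_inv]
    ring

theorem act_one : act 1 = AlgHom.id ℂ Poly := by
  refine MvPolynomial.algHom_ext ?_
  rintro (j | j) <;> fin_cases j <;> simp [act, Fin.sum_univ_two]

theorem mem_invariants_closure_iff (S : Set (GL (Fin 2) ℂ)) (f : Poly) :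
    f ∈ invariants (Subgroup.closure S) ↔ ∀ g ∈ S, act g f = f := by
  rw [mem_invariants]
  refine ⟨fun h g hg => h g (Subgroup.subset_closure hg), fun h g hg => ?_⟩
  induction hg using Subgroup.closure_induction with
  | mem g hg => exact h g hg
  | one => simp [act_one]
  | mul g k _ _ hg hk => rw [act_mul, AlgHom.comp_apply, hk, hg]
  | inv g _ hg =>
    conv_lhs => rw [← hg]
    rw [← AlgHom.comp_apply, ← act_mul, inv_mul_cancel, act_one, AlgHom.id_apply]

theorem mem_invariants_W_iff (ζ : ℂˣ) (f : Poly) :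
    f ∈ invariants (W ζ) ↔ act (s ζ 0) f = f ∧ act (s ζ 1) f = f := by
  simp [W, mem_invariants_closure_iff]

theorem s_inv (ζ : ℂˣ) (i : ℤ) : (s ζ i)⁻¹ = s ζ i := rfl

theorem act_s_x (ζ : ℂˣ) (i : ℤ) : act (s ζ i) x = C ((ζ ^ (-i) : ℂˣ) : ℂ) * y := by
  simp only [act, x, y, aeval_X, Sum.elim_inl, Fin.sum_univ_two]
  simp [s]

theorem act_s_y (ζ : ℂˣ) (i : ℤ) : act (s ζ i) y = C ((ζ ^ i : ℂˣ) : ℂ) * x := by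
  simp only [act, x, y, aeval_X, Sum.elim_inl, Fin.sum_univ_two]
  simp [s]

theorem act_s_X (ζ : ℂˣ) (i : ℤ) : act (s ζ i) X = C ((ζ ^ i : ℂˣ) : ℂ) * Y := by
  simp only [act, X, Y, aeval_X, Sum.elim_inr, Fin.sum_univ_two, s_inv]
  simp [s]

theorem act_s_Y (ζ : ℂˣ) (i : ℤ) : act (s ζ i) Y = C ((ζ ^ (-i) : ℂˣ) : ℂ) * X := by
  simp only [act, X, Y, aeval_X, Sum.elim_inr, Fin.sum_univ_two, s_inv]
  simp [s]

theorem C_zpow_neg_mul (ζ : ℂˣ) (i : ℤ) :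
    (C ((ζ ^ (-i) : ℂˣ) : ℂ) * C ((ζ ^ i : ℂˣ) : ℂ) : Poly) = 1 := by
  rw [← C_mul, ← Units.val_mul, ← zpow_add, neg_add_cancel, zpow_zero, Units.val_one, C_1]

theorem C_zpow_pow (ζ : ℂˣ) {d : ℕ} (hζ : ζ ^ d = 1) (i : ℤ) :
    (C ((ζ ^ i : ℂˣ) : ℂ) : Poly) ^ d = 1 := by
  rw [← C_pow, ← Units.val_pow_eq_pow_val, ← zpow_natCast, zpow_comm, zpow_natCast, hζ, one_zpow,
    Units.val_one, C_1]

theorem act_s_toPoly {ζ : ℂˣ} {d : ℕ} (hζ : ζ ^ d = 1) (i : ℤ) (g : Gen d) :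
    act (s ζ i) g.toPoly = g.toPoly := by
  have h1 := C_zpow_neg_mul ζ i
  cases g with
  | q =>
    simp only [Gen.toPoly, q, map_mul, act_s_x, act_s_y]
    linear_combination x * y * h1
  | Q =>
    simp only [Gen.toPoly, Q, map_mul, act_s_X, act_s_Y]
    linear_combination X * Y * h1
  | eu =>
    simp only [Gen.toPoly, eu, map_mul, map_add, act_s_x, act_s_y, act_s_X, act_s_Y]
    linear_combination (x * X + y * Y) * h1
  | a k =>
    have hk : d - (k : ℕ) + k = d := Nat.sub_add_cancel (Nat.lt_succ_iff.1 k.2)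
    have h2 : ∀ z : Poly, z ^ d = 1 → z ^ (d - (k : ℕ)) * z ^ (k : ℕ) = 1 := by
      intro z hz
      rw [← pow_add, hk, hz]
    have h3 := h2 _ (C_zpow_pow ζ hζ i)
    have h4 := h2 _ (C_zpow_pow ζ hζ (-i))
    simp only [Gen.toPoly, a, map_mul, map_add, map_pow, act_s_x, act_s_y, act_s_X, act_s_Y,
      mul_pow]
    linear_combination y ^ (d - (k : ℕ)) * X ^ (k : ℕ) * h4
      + x ^ (d - (k : ℕ)) * Y ^ (k : ℕ) * h3

theorem range_le_invariants {ζ : ℂˣ} {d : ℕ} (hζ : ζ ^ d = 1) :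
    (aeval (R := ℂ) (Gen.toPoly (d := d))).range ≤ invariants (W ζ) := by
  rw [← Algebra.adjoin_range_eq_range_aeval, Algebra.adjoin_le_iff]
  rintro _ ⟨g, rfl⟩
  exact (mem_invariants_W_iff ζ _).2 ⟨act_s_toPoly hζ 0 g, act_s_toPoly hζ 1 g⟩

/-! ### Generators of the invariant algebra -/

/-- The sum of the monomial `x ^ i y ^ j X ^ k Y ^ l` and its image under `s_0`. -/
noncomputable def symMonomial (i j k l : ℕ) : Poly :=
  x ^ i * y ^ j * X ^ k * Y ^ l + y ^ i * x ^ j * Y ^ k * X ^ l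

theorem symMonomial_swap (i j k l : ℕ) : symMonomial i j k l = symMonomial j i l k := by
  simp only [symMonomial]; ring

section Generation

variable {d : ℕ} {A : Subalgebra ℂ Poly} (hq : q ∈ A) (hQ : Q ∈ A) (heu : eu ∈ A)
include hq hQ heu

/-- A monomial with factors of both weights is divisible by `xy`, `XY`, `xX` or `yY`. The first two
split off `q` or `Q`. Otherwise multiplication by `eu` leaves a correction of the same degree, from
which `q` or `Q` splits off. -/
theorem symMonomial_mem_of_mixed {n : ℕ}
    (ih : ∀ i j k l, i + j + k + l < n → (i + l ≡ j + k [MOD d]) → symMonomial i j k l ∈ A)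
    {i j k l : ℕ} (hn : i + j + k + l = n) (hd : i + l ≡ j + k [MOD d])
    (h1 : 0 < i + l) (h2 : 0 < j + k) : symMonomial i j k l ∈ A := by
  have case_q : ∀ i j k l, i + j + k + l + 2 ≤ n → (i + l ≡ j + k [MOD d]) →
      symMonomial (i + 1) (j + 1) k l ∈ A := by
    intro i j k l h h'
    have : symMonomial (i + 1) (j + 1) k l = q * symMonomial i j k l := by
      simp only [symMonomial, q]; ring
    exact this ▸ mul_mem hq (ih _ _ _ _ (by omega) h')
  have case_Q : ∀ i j k l, i + j + k + l + 2 ≤ n → (i + l ≡ j + k [MOD d]) →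
      symMonomial i j (k + 1) (l + 1) ∈ A := by
    intro i j k l h h'
    have : symMonomial i j (k + 1) (l + 1) = Q * symMonomial i j k l := by
      simp only [symMonomial, Q]; ring
    exact this ▸ mul_mem hQ (ih _ _ _ _ (by omega) h')
  have case_eu : ∀ i k, i + k + 2 ≤ n → (i ≡ k [MOD d]) → symMonomial (i + 1) 0 (k + 1) 0 ∈ A := by
    intro i k h h'
    have e : symMonomial (i + 1) 0 (k + 1) 0
        = eu * symMonomial i 0 k 0 - symMonomial i 1 k 1 := by
      simp only [symMonomial, eu]; ring
    -- Here the correction term would be `eu` itself, with neither `q` nor `Q` to split off.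
    by_cases h0 : i = 0 ∧ k = 0
    · obtain ⟨rfl, rfl⟩ := h0
      have : symMonomial (0 + 1) 0 (0 + 1) 0 = eu := by simp [symMonomial, eu]
      exact this ▸ heu
    rw [e]
    refine sub_mem (mul_mem heu (ih _ _ _ _ (by omega) (by simpa using h'))) ?_
    rcases i with _ | i
    · rcases k with _ | k
      · exact absurd ⟨rfl, rfl⟩ h0
      · exact case_Q 0 1 k 0 (by omega) (by simpa [add_comm] using h')
    · exact case_q i 0 k 1 (by omega) (by simpa using h')
  have cancel : ∀ {u v u' v' : ℕ}, (u ≡ v [MOD d]) → u = u' + 1 → v = v' + 1 →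
      (u' ≡ v' [MOD d]) := by
    rintro u v u' v' h rfl rfl
    exact Nat.ModEq.add_right_cancel' 1 h
  rcases i with _ | i <;> rcases j with _ | j
  · obtain ⟨l, rfl⟩ : ∃ m, l = m + 1 := ⟨l - 1, by omega⟩
    obtain ⟨k, rfl⟩ : ∃ m, k = m + 1 := ⟨k - 1, by omega⟩
    exact case_Q 0 0 k l (by omega) (cancel hd (by omega) (by omega))
  · obtain ⟨l, rfl⟩ : ∃ m, l = m + 1 := ⟨l - 1, by omega⟩
    rcases k with _ | k
    · rw [symMonomial_swap]
      exact case_eu j l (by omega) (cancel hd (by omega) (by omega)).symm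
    · exact case_Q 0 (j + 1) k l (by omega) (cancel hd (by omega) (by omega))
  · obtain ⟨k, rfl⟩ : ∃ m, k = m + 1 := ⟨k - 1, by omega⟩
    rcases l with _ | l
    · exact case_eu i k (by omega) (cancel hd (by omega) (by omega))
    · exact case_Q (i + 1) 0 k l (by omega) (cancel hd (by omega) (by omega))
  · exact case_q i j k l (by omega) (cancel hd (by omega) (by omega))

theorem symMonomial_mem (ha : ∀ i ≤ d, a d i ∈ A) (i j k l : ℕ)
    (hd : i + l ≡ j + k [MOD d]) : symMonomial i j k l ∈ A := by
  induction hn : i + j + k + l using Nat.strong_induction_on generalizing i j k l with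
  | _ n ih =>
    replace ih : ∀ i j k l, i + j + k + l < n → (i + l ≡ j + k [MOD d]) →
      symMonomial i j k l ∈ A := fun i j k l h h' => ih _ h i j k l h' rfl
    -- This covers mixed monomials of degree `n` itself, so corrections of the same degree are
    -- allowed below.
    have mixed := @symMonomial_mem_of_mixed d A hq hQ heu n ih
    have pure : ∀ i l, i + l = n → d ∣ i + l → symMonomial i 0 0 l ∈ A := by
      intro i l h hdvd
      obtain ⟨c, hc⟩ := hdvd
      rcases c with _ | c
      · obtain ⟨rfl, rfl⟩ : i = 0 ∧ l = 0 := by constructor <;> omega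
        have : symMonomial 0 0 0 0 = 2 := by norm_num [symMonomial]
        exact this ▸ ofNat_mem A 2
      -- With `m = min l d`, the factor `x ^ (d - m) * Y ^ m` of `a d m` divides the monomial.
      obtain ⟨m, i', hm, hi, hl⟩ : ∃ m i', m ≤ d ∧ i = i' + (d - m) ∧ m ≤ l := by
        rcases le_total l d with hld | hld
        · have : d * (c + 1) = d * c + d := by ring
          exact ⟨l, d * c, hld, by omega, le_rfl⟩
        · exact ⟨d, i, le_rfl, by omega, hld⟩
      obtain ⟨l', rfl⟩ := Nat.exists_eq_add_of_le hl
      have hsum : i' + l' = d * c := by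
        have : d * (c + 1) = d * c + d := by ring
        omega
      rcases c.eq_zero_or_pos with rfl | hc0
      · obtain ⟨rfl, rfl⟩ : i' = 0 ∧ l' = 0 := by constructor <;> omega
        have : symMonomial i 0 0 (m + 0) = a d m := by simp [symMonomial, a, hi]
        exact this ▸ ha m hm
      rcases d.eq_zero_or_pos with rfl | hd0
      · obtain ⟨rfl, rfl⟩ : i' = 0 ∧ l' = 0 := by constructor <;> omega
        have : symMonomial i 0 0 (m + 0) = a 0 m := by simp [symMonomial, a, hi]
        exact this ▸ ha m hm
      have hcd : 0 < d * c := Nat.mul_pos hd0 hc0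
      have e : symMonomial i 0 0 (m + l') = a d m * symMonomial i' 0 0 l'
          - symMonomial (d - m) i' l' m := by
        simp only [symMonomial, a, hi]; ring
      rw [e]
      refine sub_mem (mul_mem (ha m hm) (ih _ _ _ _ (by omega) ?_)) (mixed (by omega) ?_
        (by omega) (by omega))
      · rw [hsum]; exact (Nat.modEq_zero_iff_dvd.2 (dvd_mul_right d c))
      · rw [hsum, Nat.sub_add_cancel hm]
        exact (Nat.modEq_zero_iff_dvd.2 dvd_rfl).trans
          (Nat.modEq_zero_iff_dvd.2 (dvd_mul_right d c)).symm
    by_cases h1 : 0 < i + l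
    · by_cases h2 : 0 < j + k
      · exact mixed hn hd h1 h2
      · obtain ⟨rfl, rfl⟩ : j = 0 ∧ k = 0 := by constructor <;> omega
        exact pure i l (by omega) (Nat.modEq_zero_iff_dvd.1 hd)
    · obtain ⟨rfl, rfl⟩ : i = 0 ∧ l = 0 := by constructor <;> omega
      rw [symMonomial_swap]
      exact pure j k (by omega) (Nat.modEq_zero_iff_dvd.1 hd.symm)

end Generation

theorem coeff_aeval_C_mul_X {σ : Type*} (c : σ → ℂ) (f : MvPolynomial σ ℂ) (m : σ →₀ ℕ) :
    coeff m (aeval (fun i => C (c i) * MvPolynomial.X i : σ → MvPolynomial σ ℂ) f)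
      = (m.prod fun i k => c i ^ k) * coeff m f := by
  classical
  induction f using MvPolynomial.induction_on' with
  | monomial u r =>
    rw [aeval_monomial]
    have : (u.prod fun i k => (C (c i) * MvPolynomial.X i : MvPolynomial σ ℂ) ^ k)
        = C (u.prod fun i k => c i ^ k) * monomial u 1 := by
      simp only [mul_pow, Finsupp.prod_mul]
      rw [monomial_eq, C_1, one_mul]
      simp [Finsupp.prod]
    rw [this, algebraMap_eq, C_mul_monomial, C_mul_monomial, coeff_monomial, coeff_monomial]
    split_ifs with h
    · subst h; ring
    · simp
  | add p q hp hq => rw [map_add, coeff_add, coeff_add, hp, hq, mul_add]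

theorem monomial_eq_xyXY (m : Fin 2 ⊕ Fin 2 →₀ ℕ) (r : ℂ) :
    (monomial m r : Poly) = C r * (x ^ m (.inl 0) * y ^ m (.inl 1) * X ^ m (.inr 0)
      * Y ^ m (.inr 1)) := by
  rw [monomial_eq, Finsupp.prod_fintype _ _ (by simp)]
  simp only [Fintype.prod_sum_type, Fin.prod_univ_two, x, y, X, Y]
  ring

theorem invariants_le_range {ζ : ℂˣ} {d : ℕ} (hζ : IsPrimitiveRoot ζ d) :
    invariants (W ζ) ≤ (aeval (R := ℂ) (Gen.toPoly (d := d))).range := by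
  intro f hf
  obtain ⟨h0, h1⟩ := (mem_invariants_W_iff ζ f).1 hf
  have hgen : ∀ g : Gen d, g.toPoly ∈ (aeval (R := ℂ) (Gen.toPoly (d := d))).range :=
    fun g => ⟨MvPolynomial.X g, aeval_X _ _⟩
  let c : Fin 2 ⊕ Fin 2 → ℂ := Sum.elim ![((ζ : ℂˣ) : ℂ), ((ζ⁻¹ : ℂˣ) : ℂ)]
    ![((ζ⁻¹ : ℂˣ) : ℂ), ((ζ : ℂˣ) : ℂ)]
  -- The rotation is diagonal, so invariance can be tested on each coefficient separately.
  have hrot : (act (s ζ 1)).comp (act (s ζ 0))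
      = aeval (fun i => C (c i) * MvPolynomial.X i) := by
    refine MvPolynomial.algHom_ext ?_
    have e1 := act_s_x ζ
    have e2 := act_s_y ζ
    have e3 := act_s_X ζ
    have e4 := act_s_Y ζ
    simp only [x, y, X, Y] at e1 e2 e3 e4
    rintro (j | j) <;> fin_cases j <;> simp [e1, e2, e3, e4, c]
  have hsupp : ∀ m ∈ f.support,
      m (.inl 0) + m (.inr 1) ≡ m (.inl 1) + m (.inr 0) [MOD d] := by
    intro m hm
    have h2 := DFunLike.congr_fun hrot f
    rw [AlgHom.comp_apply, h0, h1] at h2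
    have h3 := congrArg (coeff m) h2
    rw [coeff_aeval_C_mul_X, eq_comm, mul_eq_right₀ (mem_support_iff.1 hm),
      Finsupp.prod_fintype _ _ (by simp)] at h3
    have h4 : ζ ^ ((m (.inl 0) + m (.inr 1) : ℕ) - (m (.inl 1) + m (.inr 0) : ℕ) : ℤ) = 1 := by
      rw [zpow_sub, zpow_natCast, zpow_natCast, ← Units.val_inj, Units.val_one, ← h3]
      simp only [c, Fintype.prod_sum_type, Fin.prod_univ_two, Sum.elim_inl, Sum.elim_inr,
        Matrix.cons_val_zero, Matrix.cons_val_one, pow_add, mul_inv, ← inv_pow, Units.val_mul,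
        Units.val_pow_eq_pow_val]
      ring
    rw [hζ.zpow_eq_one_iff_dvd] at h4
    exact ((Nat.modEq_iff_dvd).2 h4).symm
  have hsum : f = ∑ m ∈ f.support, C (coeff m f / 2) *
      symMonomial (m (.inl 0)) (m (.inl 1)) (m (.inr 0)) (m (.inr 1)) := by
    have h2 : f + act (s ζ 0) f = ∑ m ∈ f.support, C (coeff m f) *
      symMonomial (m (.inl 0)) (m (.inl 1)) (m (.inr 0)) (m (.inr 1)) := by
      conv_lhs => rw [f.as_sum]
      rw [map_sum, ← Finset.sum_add_distrib]
      refine Finset.sum_congr rfl fun m _ => ?_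
      rw [monomial_eq_xyXY]
      simp only [map_mul, map_pow, act_s_x, act_s_y, act_s_X, act_s_Y, symMonomial]
      rw [← algebraMap_eq, AlgHom.commutes]
      simp
      ring
    have h3 : f = C (1 / 2) * (f + act (s ζ 0) f) := by
      rw [h0, ← two_mul, ← mul_assoc, show (2 : Poly) = C 2 from rfl, ← C_mul]
      norm_num
    rw [h2, Finset.mul_sum] at h3
    refine h3.trans ?_
    refine Finset.sum_congr rfl fun m _ => ?_
    rw [← mul_assoc, ← C_mul]
    congr 2
    ring
  rw [hsum]
  refine sum_mem fun m hm => mul_mem ?_ ?_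
  · rw [← algebraMap_eq]
    exact Subalgebra.algebraMap_mem _ _
  · exact symMonomial_mem (hgen .q) (hgen .Q) (hgen .eu)
      (fun i hi => hgen (.a ⟨i, Nat.lt_succ_iff.2 hi⟩)) _ _ _ _ (hsupp m hm)

/-! ### The parameters `q, Q, a_0, a_d` -/

/-- The inclusion of the polynomial ring in the parameters `q, Q, a_0, a_d`. -/
noncomputable def parameterMap (d : ℕ) : MvPolynomial (Fin 4) ℂ →ₐ[ℂ] Poly :=
  aeval ![q, Q, a d 0, a d d]

/-- Take `u ^ d` to be a root of `t ^ 2 - w t + p ^ d` and `v = p / u`. A zero root forces `p = 0`,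
and then `u = 0` works. -/
theorem exists_mul_eq_and_pow_add_pow_eq {d : ℕ} (hd : 0 < d) (p w : ℂ) :
    ∃ u v : ℂ, u * v = p ∧ u ^ d + v ^ d = w := by
  obtain ⟨r, hr⟩ := IsAlgClosed.exists_pow_nat_eq (discrim 1 (-w) (p ^ d)) (n := 2) (by simp)
  obtain ⟨t, ht⟩ := exists_quadratic_eq_zero (one_ne_zero (α := ℂ)) ⟨r, by rw [← hr]; ring⟩
  rcases eq_or_ne t 0 with rfl | ht0
  · obtain rfl : p = 0 := by
      refine pow_eq_zero_iff hd.ne' |>.1 ?_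
      linear_combination ht
    obtain ⟨v, hv⟩ := IsAlgClosed.exists_pow_nat_eq w hd
    exact ⟨0, v, by simp, by simp [hv, hd.ne']⟩
  · obtain ⟨u, rfl⟩ := IsAlgClosed.exists_pow_nat_eq t hd
    have hu : u ≠ 0 := by
      rintro rfl
      simp [hd.ne'] at ht0
    refine ⟨u, p / u, by field_simp, ?_⟩
    rw [div_pow]
    field_simp
    linear_combination ht

/-- The four parameters define a surjective map from `ℂ⁴` to `ℂ⁴`, so a polynomial in them that
vanishes has only zero values. -/
theorem parameterMap_injective {d : ℕ} (hd : 0 < d) :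
    Function.Injective (parameterMap d) := by
  rw [injective_iff_map_eq_zero]
  intro f hf
  refine MvPolynomial.funext fun w => ?_
  obtain ⟨u, v, h1, h2⟩ := exists_mul_eq_and_pow_add_pow_eq hd (w 0) (w 2)
  obtain ⟨u', v', h3, h4⟩ := exists_mul_eq_and_pow_add_pow_eq hd (w 1) (w 3)
  have h : (aeval (R := ℂ) (Sum.elim ![u, v] ![u', v'])).comp (parameterMap d) = aeval w := by
    refine MvPolynomial.algHom_ext fun k => ?_
    fin_cases k
    · simp [parameterMap, q, x, y, h1]
    · simp [parameterMap, Q, X, Y, h3]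
    · simp [parameterMap, a, x, y, X, Y, h2]
    · simp [parameterMap, a, x, y, X, Y, ← h4, add_comm]
  have h5 := DFunLike.congr_fun h f
  rw [AlgHom.comp_apply, hf, map_zero, aeval_eq_eval] at h5
  rw [map_zero]
  exact h5.symm

/-- The conjugates of `eu` over the parameters. -/
noncomputable def euConj (ζ : ℂˣ) {d : ℕ} : Fin d ⊕ Fin d → Poly :=
  Sum.elim (fun k => C ((ζ ^ (k : ℕ) : ℂˣ) : ℂ) * (x * X) + C ((ζ⁻¹ ^ (k : ℕ) : ℂˣ) : ℂ) * (y * Y))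
    (fun k => C ((ζ ^ (k : ℕ) : ℂˣ) : ℂ) * (x * Y) + C ((ζ⁻¹ ^ (k : ℕ) : ℂˣ) : ℂ) * (y * X))

theorem euConj_injective {ζ : ℂˣ} {d : ℕ} (hζ : IsPrimitiveRoot ζ d) :
    Function.Injective (euConj ζ (d := d)) := by
  have key : ∀ k l : Fin d, (ζ : ℂ) ^ (k : ℕ) = (ζ : ℂ) ^ (l : ℕ) → k = l := by
    intro k l h
    refine Fin.ext (hζ.pow_inj k.2 l.2 ?_)
    ext
    simpa using h
  -- At `x = X = 1`, `y = Y = 0` the first family takes the values `ζ ^ k` and the second vanishes;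
  -- `ev2` exchanges the roles of `X` and `Y`.
  have ev1 : ∀ z z' : Poly, z = z' → eval (Sum.elim ![1, 0] ![1, 0]) z
      = eval (Sum.elim ![1, 0] ![1, 0]) z' := fun _ _ h => congrArg _ h
  have ev2 : ∀ z z' : Poly, z = z' → eval (Sum.elim ![1, 0] ![0, 1]) z
      = eval (Sum.elim ![1, 0] ![0, 1]) z' := fun _ _ h => congrArg _ h
  rintro (k | k) (l | l) h
  · have := ev1 _ _ h
    simp [euConj, x, y, X, Y] at this
    rw [key k l this]
  · have := ev1 _ _ h
    simp [euConj, x, y, X, Y] at this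
  · have := ev1 _ _ h.symm
    simp [euConj, x, y, X, Y] at this
  · have := ev2 _ _ h
    simp [euConj, x, y, X, Y] at this
    rw [key k l this]

/-- Rotating `x, y` alone, with or without a swap of `X` and `Y`, fixes all four parameters but
moves `eu`. -/
theorem exists_algHom_map_eu {ζ : ℂˣ} {d : ℕ} (hζ : ζ ^ d = 1) (k : Fin d ⊕ Fin d) :
    ∃ σ : Poly →ₐ[ℂ] Poly, σ eu = euConj ζ k ∧ σ.comp (parameterMap d) = parameterMap d := by
  have hinv : ∀ n : ℕ, (C ((ζ ^ n : ℂˣ) : ℂ) * C ((ζ⁻¹ ^ n : ℂˣ) : ℂ) : Poly) = 1 := by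
    intro n
    rw [← C_mul, ← Units.val_mul, ← mul_pow, mul_inv_cancel, one_pow, Units.val_one, C_1]
  have hp1 : ∀ n : ℕ, (C ((ζ ^ n : ℂˣ) : ℂ) : Poly) ^ d = 1 := by
    intro n
    rw [← C_pow, ← Units.val_pow_eq_pow_val, pow_right_comm, hζ, one_pow, Units.val_one, C_1]
  have hp2 : ∀ n : ℕ, (C ((ζ⁻¹ ^ n : ℂˣ) : ℂ) : Poly) ^ d = 1 := by
    intro n
    rw [← C_pow, ← Units.val_pow_eq_pow_val, pow_right_comm, inv_pow, hζ, inv_one, one_pow,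
      Units.val_one, C_1]
  have hσ : ∀ (n : ℕ) (z z' : Poly), z * z' = Q → z ^ d + z' ^ d = a d d →
      ∃ σ : Poly →ₐ[ℂ] Poly, σ eu = C ((ζ ^ n : ℂˣ) : ℂ) * (x * z)
        + C ((ζ⁻¹ ^ n : ℂˣ) : ℂ) * (y * z') ∧ σ.comp (parameterMap d) = parameterMap d := by
    intro n z z' h1 h2
    let σ : Poly →ₐ[ℂ] Poly := aeval (Sum.elim
      ![C ((ζ ^ n : ℂˣ) : ℂ) * x, C ((ζ⁻¹ ^ n : ℂˣ) : ℂ) * y] ![z, z'])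
    have sx : σ x = C ((ζ ^ n : ℂˣ) : ℂ) * x := by simp only [σ, x, aeval_X]; rfl
    have sy : σ y = C ((ζ⁻¹ ^ n : ℂˣ) : ℂ) * y := by simp only [σ, y, aeval_X]; rfl
    have sX : σ X = z := by simp only [σ, X, aeval_X]; rfl
    have sY : σ Y = z' := by simp only [σ, Y, aeval_X]; rfl
    refine ⟨σ, ?_, MvPolynomial.algHom_ext fun k => ?_⟩
    · rw [eu, map_add, map_mul, map_mul, sx, sy, sX, sY]
      ring
    · rw [AlgHom.comp_apply, parameterMap, aeval_X]
      fin_cases k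
      · change σ q = q
        rw [q, map_mul, sx, sy]
        linear_combination x * y * hinv n
      · change σ Q = Q
        rw [Q, map_mul, sX, sY, h1, Q]
      · change σ (a d 0) = a d 0
        simp only [a, map_add, map_pow, sx, sy, mul_pow, Nat.sub_zero, hp1, hp2, pow_zero,
          one_mul, mul_one]
      · change σ (a d d) = a d d
        have h3 : σ (a d d) = z' ^ d + z ^ d := by
          simp only [a, map_add, map_pow, sX, sY, Nat.sub_self, pow_zero, one_mul]
        rw [h3, ← h2, add_comm]
  rcases k with k | k
  · exact hσ k X Y rfl (by simp [a, add_comm])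
  · exact hσ k Y X (mul_comm _ _) (by simp [a])

/-- A relation is a polynomial of degree less than `2 * d` that vanishes at all `2 * d` conjugates
of `eu`, hence is zero. -/
theorem linearIndependent_eu_pow {ζ : ℂˣ} {d : ℕ} (hd : 0 < d) (hζ : IsPrimitiveRoot ζ d)
    (c : Fin (2 * d) → MvPolynomial (Fin 4) ℂ)
    (hc : ∑ k, parameterMap d (c k) * eu ^ (k : ℕ) = 0) : c = 0 := by
  let G : Polynomial Poly := ∑ k, Polynomial.C (parameterMap d (c k)) * Polynomial.X ^ (k : ℕ)
  have hG : G = 0 := by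
    refine Polynomial.eq_zero_of_natDegree_lt_card_of_eval_eq_zero G (euConj_injective hζ)
      (fun k => ?_) ?_
    · obtain ⟨σ, h1, h2⟩ := exists_algHom_map_eu hζ.pow_eq_one k
      have h3 := congrArg σ hc
      simp only [map_sum, map_mul, map_pow, h1, map_zero, ← AlgHom.comp_apply, h2] at h3
      simpa [G, Polynomial.eval_finsetSum] using h3
    · rw [Fintype.card_sum, Fintype.card_fin, ← two_mul]
      refine Nat.lt_of_le_pred (by omega) (Polynomial.natDegree_sum_le_of_forall_le _ _ ?_)
      intro k _
      exact (Polynomial.natDegree_C_mul_X_pow_le _ _).trans (Nat.le_pred_of_lt k.2)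
  ext1 k
  refine parameterMap_injective hd ?_
  have h := congrArg (fun p => Polynomial.coeff p (k : ℕ)) hG
  simpa [G, Polynomial.finsetSum_coeff, Polynomial.coeff_X_pow, Fin.val_inj] using h

/-! ### The kernel -/

theorem map_psi {B C : Type*} [CommRing B] [CommRing C] (f : B →+* C) (e p : B) (n : ℕ) :
    f (psi e p n) = psi (f e) (f p) n := by
  induction n using Nat.twoStepInduction with
  | zero => simp [psi]
  | one => simp [psi]
  | more n h0 h1 => simp [psi, h0, h1]

theorem psi_eu_mul (n : ℕ) :
    psi eu (q * Q) n * (x * X - y * Y) = (x * X) ^ (n + 1) - (y * Y) ^ (n + 1) := by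
  rw [← aeval_Psi, aeval_Psi_eq_psi]

theorem relations_le_ker (d : ℕ) :
    Ideal.span (relLinear d ∪ relQuadratic d)
      ≤ RingHom.ker (aeval (R := ℂ) (Gen.toPoly (d := d))) := by
  rw [Ideal.span_le]
  rintro _ (⟨i, h1, h2, rfl⟩ | ⟨i, j, h1, hij, h2, rfl⟩)
  · obtain ⟨i, rfl⟩ := Nat.exists_eq_add_of_le' h1
    obtain ⟨n, rfl⟩ : ∃ n, d = n + i + 2 := ⟨d - i - 2, by omega⟩
    have e1 : n + i + 2 - i = n + 2 := by omega
    have e2 : n + i + 2 - (i + 1) = n + 1 := by omega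
    have e3 : n + i + 2 - (i + 1 + 1) = n := by omega
    simp only [SetLike.mem_coe, RingHom.mem_ker, map_sub, map_mul, map_add, aeval_X, Gen.toPoly,
      eu, q, Q, a, Nat.add_sub_cancel, e1, e2, e3]
    ring
  · obtain ⟨i, rfl⟩ := Nat.exists_eq_add_of_le' h1
    obtain ⟨m, rfl⟩ := Nat.exists_eq_add_of_le hij
    obtain ⟨n, rfl⟩ : ∃ n, d = n + i + m + 2 := ⟨d - i - m - 2, by omega⟩
    have e1 : n + i + m + 2 - i = n + m + 2 := by omega
    have e2 : n + i + m + 2 - (i + 1) = n + m + 1 := by omega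
    have e3 : n + i + m + 2 - (i + 1 + m + 1) = n := by omega
    have e4 : n + i + m + 2 - (i + 1 + m) = n + 1 := by omega
    have e5 : i + 1 + m - (i + 1) = m := by omega
    have h := psi_eu_mul m
    -- `eu ^ 2 - 4 * q * Q` is the square of `x * X - y * Y`, and one factor clears the denominator
    -- of `psi`.
    have h3 : (eu ^ 2 - 4 * q * Q) * psi eu (q * Q) m
        = (x * X - y * Y) * ((x * X) ^ (m + 1) - (y * Y) ^ (m + 1)) := by
      rw [← h, eu, q, Q]
      ring
    simp only [SetLike.mem_coe, RingHom.mem_ker, map_sub, map_mul, map_pow, aeval_X,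
      aeval_Psi_eq_psi, map_ofNat, Gen.toPoly, Nat.add_sub_cancel, e4, e5]
    rw [← AlgHom.coe_toRingHom, map_psi]
    simp only [AlgHom.coe_toRingHom, map_mul, aeval_X, Gen.toPoly, a, e1, e2, e3, e4]
    have h4 : (x * y) ^ n * (X * Y) ^ i = q ^ n * Q ^ i := rfl
    linear_combination (-(q ^ n * Q ^ i)) * h3 + (x * X - y * Y) * ((x * X) ^ (m + 1)
      - (y * Y) ^ (m + 1)) * h4

/-- The span contains 1 and is stable under multiplication by every generator. -/
theorem Relations.span_family_eq_top {P B : Type*} [CommRing P] [CommRing B] [Algebra P B] {d : ℕ}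
    (hd : 2 ≤ d) (g : MvPolynomial (Gen d) ℂ →+* B) (hg : Function.Surjective g)
    (c : ℂ →+* P) (hc : ∀ r, g (C r) = algebraMap P B (c r)) {q Q α δ : P} {a : ℕ → B}
    (hq : g (.X .q) = algebraMap P B q) (hQ : g (.X .Q) = algebraMap P B Q)
    (ha : ∀ i : Fin (d + 1), g (.X (.a i)) = a i)
    (h : Relations d q Q α δ (g (.X .eu)) a) :
    Submodule.span P (Set.range (family d (g (.X .eu)) a)) = ⊤ := by
  rw [eq_top_iff]
  rintro z -
  obtain ⟨f, rfl⟩ := hg z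
  induction f using MvPolynomial.induction_on with
  | C r =>
    rw [hc, Algebra.algebraMap_eq_smul_one]
    refine Submodule.smul_mem _ _ ?_
    simpa using pow_mem_span_family (P := P) (e := g (.X .eu)) (a := a) hd (Nat.zero_le d)
  | add f f' hf hf' => rw [map_add]; exact add_mem hf hf'
  | mul_X f k hf =>
    rw [map_mul, mul_comm (g f)]
    cases k with
    | q => rw [hq, ← Algebra.smul_def]; exact Submodule.smul_mem _ _ hf
    | Q => rw [hQ, ← Algebra.smul_def]; exact Submodule.smul_mem _ _ hf
    | eu => exact h.eu_mul_mem hd hf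
    | a i => rw [ha]; exact h.a_mul_mem hd (Nat.lt_succ_iff.1 i.2) hf

theorem injective_of_span_of_pow {P B C : Type*} [CommRing P] [IsDomain P] [CommRing B]
    [CommRing C] [Algebra P B] [Algebra P C] {n : ℕ} (π : B →ₐ[P] C) (b : Fin n → B)
    (hb : Submodule.span P (Set.range b) = ⊤) (e : B)
    (he : ∀ c : Fin n → P, ∑ k, algebraMap P C (c k) * π e ^ (k : ℕ) = 0 → c = 0) :
    Function.Injective π := by
  refine injective_of_span_of_linearIndependent π.toLinearMap b hb (fun k => e ^ (k : ℕ)) ?_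
  refine Fintype.linearIndependent_iff.2 fun c hc => congrFun (he c ?_)
  simpa only [AlgHom.toLinearMap_apply, map_pow, Algebra.smul_def] using hc

theorem ker_le_relations {ζ : ℂˣ} {d : ℕ} (hd : 2 ≤ d) (hζ : IsPrimitiveRoot ζ d) :
    RingHom.ker (aeval (R := ℂ) (Gen.toPoly (d := d)))
      ≤ Ideal.span (relLinear d ∪ relQuadratic d) := by
  set I := Ideal.span (relLinear d ∪ relQuadratic d)
  let g : MvPolynomial (Gen d) ℂ →+* MvPolynomial (Gen d) ℂ ⧸ I := Ideal.Quotient.mk I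
  let ι : MvPolynomial (Fin 4) ℂ →ₐ[ℂ] MvPolynomial (Gen d) ℂ :=
    aeval ![.X .q, .X .Q, .X (.a 0), .X (.a (Fin.last d))]
  let _ : Algebra (MvPolynomial (Fin 4) ℂ) (MvPolynomial (Gen d) ℂ ⧸ I) :=
    (g.comp ι.toRingHom).toAlgebra
  let _ : Algebra (MvPolynomial (Fin 4) ℂ) Poly := (parameterMap d).toRingHom.toAlgebra
  have hB : ∀ p, algebraMap (MvPolynomial (Fin 4) ℂ) (MvPolynomial (Gen d) ℂ ⧸ I) p = g (ι p) :=
    fun _ => rfl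
  have hC : ∀ p, algebraMap (MvPolynomial (Fin 4) ℂ) Poly p = parameterMap d p := fun _ => rfl
  have hι : (aeval (R := ℂ) (Gen.toPoly (d := d))).comp ι = parameterMap d := by
    refine MvPolynomial.algHom_ext fun k => ?_
    fin_cases k <;> simp [ι, parameterMap, Gen.toPoly]
  have ι0 : ι (.X 0) = .X .q := by simp [ι]
  have ι1 : ι (.X 1) = .X .Q := by simp [ι]
  have ι2 : ι (.X 2) = .X (.a 0) := by simp [ι]
  have ι3 : ι (.X 3) = .X (.a (Fin.last d)) := by simp [ι]
  let π : (MvPolynomial (Gen d) ℂ ⧸ I) →ₐ[MvPolynomial (Fin 4) ℂ] Poly :=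
    { Ideal.Quotient.lift I (aeval (R := ℂ) (Gen.toPoly (d := d))).toRingHom
        (fun z hz => relations_le_ker d hz) with
      commutes' := fun p => DFunLike.congr_fun hι p }
  have hπ : ∀ f, π (g f) = aeval (R := ℂ) (Gen.toPoly (d := d)) f := fun _ => rfl
  -- The value 0 beyond `d` is never used: the relations involve only indices up to `d`.
  let b : ℕ → MvPolynomial (Gen d) ℂ ⧸ I :=
    fun i => if h : i < d + 1 then g (.X (.a ⟨i, h⟩)) else 0
  have hb : ∀ i (h : i < d + 1), b i = g (.X (.a ⟨i, h⟩)) := fun i h => dif_pos h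
  have hrel : Relations (P := MvPolynomial (Fin 4) ℂ) d (.X 0) (.X 1) (.X 2) (.X 3)
      (g (.X .eu)) b := by
    refine ⟨?_, ?_, fun i h1 h2 => ?_, fun i j h1 hij h2 => ?_⟩
    · rw [hb 0 (by omega), hB, ι2]; rfl
    · rw [hb d (by omega), hB, ι3]; rfl
    · rw [hb i (by omega), hb (i + 1) (by omega), hb (i - 1) (by omega), Algebra.smul_def,
        Algebra.smul_def, hB, hB, ι0, ι1, ← map_mul, ← map_mul, ← map_mul, ← map_add]
      exact Ideal.Quotient.eq.2 (Ideal.subset_span (Or.inl ⟨i, h1, h2, rfl⟩))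
    · rw [hb i (by omega), hb j (by omega), hb (j + 1) (by omega), hb (i - 1) (by omega),
        Algebra.smul_def, hB, hB, hB]
      simp only [map_mul, map_pow, map_ofNat, ι0, ι1]
      have h3 := Ideal.Quotient.eq.2 (Ideal.subset_span (s := relLinear d ∪ relQuadratic d)
        (Or.inr ⟨i, j, h1, hij, h2, rfl⟩))
      rw [aeval_Psi_eq_psi] at h3
      change g _ = g _ at h3
      simp only [map_mul, map_sub, map_pow, map_ofNat, map_psi] at h3
      rw [h3]
      ring
  have htop := hrel.span_family_eq_top hd g Ideal.Quotient.mk_surjective MvPolynomial.C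
    (fun r => by rw [hB]; exact congrArg g (ι.commutes r).symm) (by rw [hB, ι0]) (by rw [hB, ι1])
    (fun i => (hb i i.2).symm)
  have he : π (g (.X .eu)) = eu := by rw [hπ, aeval_X, Gen.toPoly]
  have hinj : Function.Injective π := injective_of_span_of_pow π _ htop _ fun c hc => by
    rw [he] at hc
    exact linearIndependent_eu_pow (by omega) hζ c hc
  intro f hf
  rw [RingHom.mem_ker, ← hπ] at hf
  exact Ideal.Quotient.eq_zero_iff_mem.1 (hinj (hf.trans (map_zero π).symm))

end DihedralInvariants

theorem mainTheorem7 (d : ℕ) (hd : 2 ≤ d) (ζ : ℂˣ) (hζ : IsPrimitiveRoot ζ d) :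
    (MvPolynomial.aeval (R := ℂ) (DihedralInvariants.Gen.toPoly (d := d))).range
        = DihedralInvariants.invariants (DihedralInvariants.W ζ) ∧
    RingHom.ker (MvPolynomial.aeval (R := ℂ) (DihedralInvariants.Gen.toPoly (d := d)))
        = Ideal.span (DihedralInvariants.relLinear d ∪ DihedralInvariants.relQuadratic d) :=
  ⟨le_antisymm (DihedralInvariants.range_le_invariants hζ.pow_eq_one)
      (DihedralInvariants.invariants_le_range hζ),
    le_antisymm (DihedralInvariants.ker_le_relations hd hζ)
      (DihedralInvariants.relations_le_ker d)⟩
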